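/- Let $H$ be an infinite-dimensional separable complex Hilbert space, and for $T\in B(H)$ let $(T)$ denote the principal ideal generated by $T$, i.e. the smallest two-sided ideal of $B(H)$ containing $T$. Fix an orthonormal basis of $H$ and split it into consecutive blocks of sizes $1,2,3,\dots$. For $1\le k\le n$ put $$a_{k,n}=\frac{\sqrt{n+1-k}}{n},\qquad b_{k,n}=\frac{\sqrt{k}}{n+1},\qquad x_{k,n}=\frac{\sqrt{k}}{n},\qquad y_{k,n}=\frac{\sqrt{n+1-k}}{n+1}.$$ Let $A_n,X_n$ be the $n\times(n+1)$ matrices and $B_n,Y_n$ the $(n+1)\times n$ matrices whose only nonzero entries are, for $1\le k\le n$, $$(A_n)_{k,k}=a_{k,n},\qquad (X_n)_{k,k+1}=x_{k,n},\qquad (B_n)_{k+1,k}=-b_{k,n},\qquad (Y_n)_{k,k}=y_{k,n}.$$ Let $C$ and $Z$ be the bounded operators on $H$ given by Anderson's construction (with $t=1/2$), i.e. by the block tridiagonal matrices $$C=\begin{pmatrix}0&A_1&0&\cdots\\ B_1&0&A_2&\ddots\\ 0&B_2&0&\ddots\\ \vdots&\ddots&\ddots&\ddots\end{pmatrix},\qquad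 Z=\begin{pmatrix}0&X_1&0&\cdots\\ Y_1&0&X_2&\ddots\\ 0&Y_2&0&\ddots\\ \vdots&\ddots&\ddots&\ddots\end{pmatrix}.$$ Then $CZ-ZC=P$, the rank-one orthogonal projection onto the span of the first basis vector, and $$(C)=(Z)=\bigl(\operatorname{diag}\langle n^{-1/4}\rangle_{n\ge1}\bigr),$$ where $\operatorname{diag}\langle n^{-1/4}\rangle_{n\ge 1}$ is the diagonal operator with diagonal entries $n^{-1/4}$, $n=1,2,3,\dots$, in an orthonormal basis of $H$ (any one: the ideal does not depend on it). -/

import Mathlib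

noncomputable section

namespace Anderson

/-- The bounded operator `T` has matrix `M` in the orthonormal basis `e`:
`⟨e i, T (e j)⟩ = M i j`, the inner product being linear in the second variable. -/
def HasMatrix {ι H : Type*} [NormedAddCommGroup H] [InnerProductSpace ℂ H]
    (e : HilbertBasis ι ℂ H) (T : H →L[ℂ] H) (M : Matrix ι ι ℂ) : Prop :=
  ∀ i j, inner ℂ (e i) (T (e j)) = M i j

/-- A bounded operator is determined by its matrix in an orthonormal basis. -/
theorem HasMatrix.unique {ι H : Type*} [NormedAddCommGroup H] [InnerProductSpace ℂ H]
    {e : HilbertBasis ι ℂ H} {S T : H →L[ℂ] H} {M : Matrix ι ι ℂ}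
    (hS : HasMatrix e S M) (hT : HasMatrix e T M) : S = T := by
  have h : ∀ j, S (e j) = T (e j) := by
    intro j
    apply e.repr.injective
    ext i
    rw [e.repr_apply_apply, e.repr_apply_apply, hS, hT]
  refine ContinuousLinearMap.ext_on (s := Set.range e) ?_ ?_
  · exact Submodule.dense_iff_topologicalClosure_eq_top.2 e.dense_span
  · rintro _ ⟨j, rfl⟩
    exact h j

/-- The bounded operator with matrix `M` in the orthonormal basis `e`. -/
def opOfMatrix {ι H : Type*} [NormedAddCommGroup H] [InnerProductSpace ℂ H]
    (e : HilbertBasis ι ℂ H) (M : Matrix ι ι ℂ)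
    (h : ∃ T : H →L[ℂ] H, HasMatrix e T M) : H →L[ℂ] H := h.choose

theorem hasMatrix_opOfMatrix {ι H : Type*} [NormedAddCommGroup H] [InnerProductSpace ℂ H]
    (e : HilbertBasis ι ℂ H) (M : Matrix ι ι ℂ)
    (h : ∃ T : H →L[ℂ] H, HasMatrix e T M) : HasMatrix e (opOfMatrix e M h) M :=
  h.choose_spec

/-- Weighted shifts with weights bounded by `1` along an injective map of the index set
are bounded operators. -/
theorem exists_weighted {ι H : Type*} [NormedAddCommGroup H] [InnerProductSpace ℂ H]
    [CompleteSpace H] (e : HilbertBasis ι ℂ H) (σ : ι → ι) (hσ : Function.Injective σ)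
    (w : ι → ℂ) (hw : ∀ i, ‖w i‖ ≤ 1) :
    ∃ T : H →L[ℂ] H, ∀ j, T (e j) = w j • e (σ j) := by
  classical
  have hle : ∀ (g : lp (fun _ : ι => ℂ) 2) (i : ι), ‖w i * g i‖ ≤ ‖g i‖ := fun g i => by
    rw [norm_mul]
    exact mul_le_of_le_one_left (norm_nonneg _) (hw i)
  have hmem : ∀ g : lp (fun _ : ι => ℂ) 2, Memℓp (fun i => w i * g i) 2 :=
    fun g => (lp.memℓp g).mono' (hle g)
  let L : lp (fun _ : ι => ℂ) 2 →ₗ[ℂ] lp (fun _ : ι => ℂ) 2 :=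
    { toFun := fun g => ⟨fun i => w i * g i, hmem g⟩
      map_add' := fun f g => by ext i; exact mul_add _ _ _
      map_smul' := fun c g => by ext i; exact mul_left_comm _ _ _ }
  let D : lp (fun _ : ι => ℂ) 2 →L[ℂ] lp (fun _ : ι => ℂ) 2 :=
    L.mkContinuous 1 (fun g => by
      rw [one_mul]
      exact lp.norm_mono (by norm_num) (fun i => hle g i))
  have ho : Orthonormal ℂ (fun i => e (σ i)) := e.orthonormal.comp σ hσ
  let V := ho.orthogonalFamily.linearIsometry
  refine ⟨V.toContinuousLinearMap ∘L D ∘L e.repr.toLinearIsometry.toContinuousLinearMap, ?_⟩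
  intro j
  have h1 : D (e.repr (e j)) = lp.single 2 j (w j) := by
    rw [e.repr_self]
    ext i
    change w i * (lp.single 2 j (1 : ℂ) : lp (fun _ : ι => ℂ) 2) i = _
    by_cases hij : i = j
    · subst hij; simp
    · simp [lp.single_apply, hij]
  change V (D (e.repr (e j))) = _
  rw [h1]
  simp [V, OrthogonalFamily.linearIsometry_apply_single]

/-- The index set of an orthonormal basis split into consecutive blocks of sizes `1, 2, 3, …`:
the pair `⟨m, i⟩` is the `(i + 1)`-st vector of the block of size `m + 1`. -/
abbrev BlockIndex : Type := Σ m : ℕ, Fin (m + 1)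

/-- The block tridiagonal matrix with central blocks of sizes `1, 2, 3, …` which are zero, with
upper off-diagonal blocks `U 1, U 2, …` and lower off-diagonal blocks `L 1, L 2, …`: the block
`U n` stands in block row `n` and block column `n + 1`, and the block `L n` in block row `n + 1`
and block column `n` (block rows and columns numbered from `1`, by their sizes). -/
def blockMatrix (U : ∀ n : ℕ, Matrix (Fin n) (Fin (n + 1)) ℂ)
    (L : ∀ n : ℕ, Matrix (Fin (n + 1)) (Fin n) ℂ) : Matrix BlockIndex BlockIndex ℂ :=
  fun p q =>
    if h : q.1 = p.1 + 1 then U (p.1 + 1) p.2 (Fin.cast (by omega) q.2)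
    else if h : p.1 = q.1 + 1 then L (q.1 + 1) (Fin.cast (by omega) p.2) q.2
    else 0

/-- `a_{k,n} = √(n + 1 - k) / n`, for `1 ≤ k ≤ n`. -/
def a (k n : ℕ) : ℝ := √((n : ℝ) + 1 - k) / n

/-- `b_{k,n} = √k / (n + 1)`, for `1 ≤ k ≤ n`. -/
def b (k n : ℕ) : ℝ := √(k : ℝ) / ((n : ℝ) + 1)

/-- `x_{k,n} = √k / n`, for `1 ≤ k ≤ n`. -/
def x (k n : ℕ) : ℝ := √(k : ℝ) / n

/-- `y_{k,n} = √(n + 1 - k) / (n + 1)`, for `1 ≤ k ≤ n`. -/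
def y (k n : ℕ) : ℝ := √((n : ℝ) + 1 - k) / ((n : ℝ) + 1)

/-- The `n × (n + 1)` matrix with `a_{k,n}` at position `(k, k)` for `1 ≤ k ≤ n`
(positions numbered from `1`) and zeros elsewhere. -/
def A (n : ℕ) : Matrix (Fin n) (Fin (n + 1)) ℂ :=
  fun i j => if (j : ℕ) = i then (a (i + 1) n : ℂ) else 0

/-- The `(n + 1) × n` matrix with `-b_{k,n}` at position `(k + 1, k)` for `1 ≤ k ≤ n`
and zeros elsewhere. -/
def B (n : ℕ) : Matrix (Fin (n + 1)) (Fin n) ℂ :=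
  fun i j => if (i : ℕ) = j + 1 then -(b (j + 1) n : ℂ) else 0

/-- The `n × (n + 1)` matrix with `x_{k,n}` at position `(k, k + 1)` for `1 ≤ k ≤ n`
and zeros elsewhere. -/
def X (n : ℕ) : Matrix (Fin n) (Fin (n + 1)) ℂ :=
  fun i j => if (j : ℕ) = i + 1 then (x (i + 1) n : ℂ) else 0

/-- The `(n + 1) × n` matrix with `y_{k,n}` at position `(k, k)` for `1 ≤ k ≤ n`
and zeros elsewhere. -/
def Y (n : ℕ) : Matrix (Fin (n + 1)) (Fin n) ℂ :=
  fun i j => if (i : ℕ) = j then (y (j + 1) n : ℂ) else 0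

/-- The map of indices taking the `k`-th vector of a block to the `k`-th vector of the next. -/
def shift (p : BlockIndex) : BlockIndex := ⟨p.1 + 1, p.2.castSucc⟩

/-- The map of indices taking the `k`-th vector of a block to the `(k+1)`-st of the next. -/
def shiftSucc (p : BlockIndex) : BlockIndex := ⟨p.1 + 1, p.2.succ⟩

theorem blockIndex_ext {p q : BlockIndex} (h : p.1 = q.1) (h' : (p.2 : ℕ) = q.2) : p = q := by
  obtain ⟨m, i⟩ := p
  obtain ⟨n, j⟩ := q
  obtain rfl : m = n := h
  obtain rfl : i = j := Fin.ext h'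
  rfl

theorem eq_shift_iff {p q : BlockIndex} : p = shift q ↔ p.1 = q.1 + 1 ∧ (p.2 : ℕ) = q.2 :=
  ⟨fun h => by subst h; simp [shift], fun h => blockIndex_ext h.1 (by simp [shift, h.2])⟩

theorem eq_shiftSucc_iff {p q : BlockIndex} :
    p = shiftSucc q ↔ p.1 = q.1 + 1 ∧ (p.2 : ℕ) = q.2 + 1 :=
  ⟨fun h => by subst h; simp [shiftSucc], fun h => blockIndex_ext h.1 (by simp [shiftSucc, h.2])⟩

theorem shift_injective : Function.Injective shift := fun p q h => by
  have := eq_shift_iff.1 h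
  exact blockIndex_ext (by simpa [shift] using this.1) (by simpa [shift] using this.2)

theorem shiftSucc_injective : Function.Injective shiftSucc := fun p q h => by
  have := eq_shiftSucc_iff.1 h
  exact blockIndex_ext (by simpa [shiftSucc] using this.1) (by simpa [shiftSucc] using this.2)

/-- A combination of a backward weighted shift and a forward weighted shift is bounded. -/
theorem exists_sum {H : Type*} [NormedAddCommGroup H] [InnerProductSpace ℂ H] [CompleteSpace H]
    (e : HilbertBasis BlockIndex ℂ H) (σ τ : BlockIndex → BlockIndex)
    (hσ : Function.Injective σ) (hτ : Function.Injective τ) (u v : BlockIndex → ℝ)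
    (hu : ∀ p, |u p| ≤ 1) (hv : ∀ p, |v p| ≤ 1) :
    ∃ T : H →L[ℂ] H, ∀ p q, inner ℂ (e p) (T (e q)) =
      (if q = σ p then (u p : ℂ) else 0) + (if p = τ q then (v q : ℂ) else 0) := by
  classical
  have hin : ∀ p q, inner ℂ (e p) (e q) = if p = q then (1 : ℂ) else 0 :=
    orthonormal_iff_ite.1 e.orthonormal
  obtain ⟨S, hS⟩ := exists_weighted e σ hσ (fun p => (u p : ℂ)) (fun p => by simpa using hu p)
  obtain ⟨R, hR⟩ := exists_weighted e τ hτ (fun p => (v p : ℂ)) (fun p => by simpa using hv p)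
  refine ⟨ContinuousLinearMap.adjoint S + R, fun p q => ?_⟩
  rw [_root_.add_apply, inner_add_right, ContinuousLinearMap.adjoint_inner_right,
    hS, hR, inner_smul_left, inner_smul_right, hin, hin]
  simp [eq_comm]

theorem abs_sqrt_div_le {s n : ℝ} (hn : 1 ≤ n) (hs : s ≤ n) : |√s / n| ≤ 1 := by
  have h0 : (0 : ℝ) < n := by linarith
  rw [abs_of_nonneg (by positivity), div_le_one h0, Real.sqrt_le_left h0.le]
  nlinarith

theorem exists_C {H : Type*} [NormedAddCommGroup H] [InnerProductSpace ℂ H] [CompleteSpace H]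
    (e : HilbertBasis BlockIndex ℂ H) : ∃ T : H →L[ℂ] H, HasMatrix e T (blockMatrix A B) := by
  obtain ⟨T, hT⟩ := exists_sum e shift shiftSucc shift_injective shiftSucc_injective
    (fun p => a (p.2 + 1) (p.1 + 1)) (fun p => -b (p.2 + 1) (p.1 + 1))
    (fun p => by
      refine abs_sqrt_div_le ?_ ?_ <;> push_cast <;>
        linarith [Nat.cast_nonneg (α := ℝ) p.1, Nat.cast_nonneg (α := ℝ) (p.2 : ℕ)])
    (fun p => by
      have : ((p.2 : ℕ) : ℝ) ≤ p.1 := by exact_mod_cast Nat.lt_succ_iff.1 p.2.2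
      rw [abs_neg]
      refine abs_sqrt_div_le ?_ ?_ <;> push_cast <;> linarith [Nat.cast_nonneg (α := ℝ) p.1])
  refine ⟨T, fun p q => ?_⟩
  rw [hT]
  simp only [eq_shift_iff, eq_shiftSucc_iff, blockMatrix, A, B]
  split_ifs <;> first | omega | simp_all

theorem exists_Z {H : Type*} [NormedAddCommGroup H] [InnerProductSpace ℂ H] [CompleteSpace H]
    (e : HilbertBasis BlockIndex ℂ H) : ∃ T : H →L[ℂ] H, HasMatrix e T (blockMatrix X Y) := by
  obtain ⟨T, hT⟩ := exists_sum e shiftSucc shift shiftSucc_injective shift_injective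
    (fun p => x (p.2 + 1) (p.1 + 1)) (fun p => y (p.2 + 1) (p.1 + 1))
    (fun p => by
      have : ((p.2 : ℕ) : ℝ) ≤ p.1 := by exact_mod_cast Nat.lt_succ_iff.1 p.2.2
      refine abs_sqrt_div_le ?_ ?_ <;> push_cast <;> linarith [Nat.cast_nonneg (α := ℝ) p.1])
    (fun p => by
      refine abs_sqrt_div_le ?_ ?_ <;> push_cast <;>
        linarith [Nat.cast_nonneg (α := ℝ) p.1, Nat.cast_nonneg (α := ℝ) (p.2 : ℕ)])
  refine ⟨T, fun p q => ?_⟩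
  rw [hT]
  simp only [eq_shift_iff, eq_shiftSucc_iff, blockMatrix, X, Y]
  split_ifs <;> first | omega | simp_all

/-- The operator `C` whose block matrix in the basis `e` has upper off-diagonal blocks
`A 1, A 2, …`, lower off-diagonal blocks `B 1, B 2, …`, and zeros elsewhere. -/
def C {H : Type*} [NormedAddCommGroup H] [InnerProductSpace ℂ H] [CompleteSpace H]
    (e : HilbertBasis BlockIndex ℂ H) : H →L[ℂ] H :=
  opOfMatrix e (blockMatrix A B) (exists_C e)

/-- The operator `Z` whose block matrix in the basis `e` has upper off-diagonal blocks
`X 1, X 2, …`, lower off-diagonal blocks `Y 1, Y 2, …`, and zeros elsewhere. -/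
def Z {H : Type*} [NormedAddCommGroup H] [InnerProductSpace ℂ H] [CompleteSpace H]
    (e : HilbertBasis BlockIndex ℂ H) : H →L[ℂ] H :=
  opOfMatrix e (blockMatrix X Y) (exists_Z e)

/-- The sequence `n ^ (-1/4)`, `n = 1, 2, 3, …`, indexed from `0`. -/
def fourthRootSeq (n : ℕ) : ℝ := ((n : ℝ) + 1) ^ (-(1 / 4) : ℝ)

theorem exists_diagFourthRoot {H : Type*} [NormedAddCommGroup H] [InnerProductSpace ℂ H]
    [CompleteSpace H] (f : HilbertBasis ℕ ℂ H) :
    ∃ T : H →L[ℂ] H, HasMatrix f T (Matrix.diagonal fun n => (fourthRootSeq n : ℂ)) := by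
  obtain ⟨T, hT⟩ := exists_weighted f id Function.injective_id (fun n => (fourthRootSeq n : ℂ))
    (fun n => by
      have h0 : (0 : ℝ) ≤ n := Nat.cast_nonneg n
      have h1 : 0 ≤ fourthRootSeq n := by unfold fourthRootSeq; positivity
      have h2 : fourthRootSeq n ≤ 1 :=
        Real.rpow_le_one_of_one_le_of_nonpos (by linarith) (by norm_num)
      rwa [Complex.norm_real, Real.norm_of_nonneg h1])
  refine ⟨T, fun i j => ?_⟩
  rw [hT, inner_smul_right, id, orthonormal_iff_ite.1 f.orthonormal, Matrix.diagonal_apply]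
  split_ifs with h <;> simp [h]

/-- The diagonal operator `diag (n ^ (-1/4))_{n ≥ 1}` in the orthonormal basis `f`. -/
def diagFourthRoot {H : Type*} [NormedAddCommGroup H] [InnerProductSpace ℂ H]
    [CompleteSpace H] (f : HilbertBasis ℕ ℂ H) : H →L[ℂ] H :=
  opOfMatrix f (Matrix.diagonal fun n => (fourthRootSeq n : ℂ)) (exists_diagFourthRoot f)

/-- The principal ideal of `B(H)` generated by `T`, i.e. the smallest two-sided ideal of the ring
of bounded operators which contains `T`. -/
def principalIdeal {H : Type*} [NormedAddCommGroup H] [InnerProductSpace ℂ H]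
    (T : H →L[ℂ] H) : TwoSidedIdeal (H →L[ℂ] H) :=
  TwoSidedIdeal.span {T}

end Anderson

end

/-!
Write `e_{m,i}` for the basis vectors, with block number `m` and position `i`, both counted from
`0`. All the operators involved are built from weighted shifts of a basis, so everything reduces
to explicit weights.

*The commutator.* `C = S† + R` and `Z = S'† + R'`, where `S`, `R'` are weighted shifts along
`e_{m,i} ↦ e_{m+1,i}` and `R`, `S'` along `e_{m,i} ↦ e_{m+1,i+1}`
(`exists_C_eq_adjoint_add`, `exists_Z_eq_adjoint_add`). The weights make `S` commute with `S'`, and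
`R` with `R'`. The four remaining products are diagonal, and they telescope to the projection
(`commutator_eq`).

*`C` and `Z` lie in the ideal of the diagonal operator.* All entries in block `m` are at most
`(m + 1)^(-1/2)`, and `(m, i) ↦ Nat.pair i m` injects the block indices into `ℕ` with values below
`(m + 1)^2`. So each weighted shift above is obtained from `diag (n^(-1/4))` by multiplying with
bounded operators on both sides (`exists_shift_mem_principalIdeal`).

*The diagonal operator lies in the ideals of `C` and `Z`.* Selecting columns in blocks `≡ 1` and
rows in blocks `≡ 0` modulo `3` separates the block just above the diagonal from the one just
below it, so a compression of `C` to suitable families of basis vectors is diagonal. The families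
are indexed by `ℕ` through `Nat.unpair`. The `n`-th pair sits in a block of number `O(√n)`, in its
first third, where the entries of `A` are at least a constant times the inverse square root of the
block number. So the diagonal of the compression dominates `n^(-1/4)`
(`mem_principalIdeal_of_diagonal_submatrix`). For `Z` the roles of rows and columns are exchanged.
-/

noncomputable section

namespace Anderson

open ContinuousLinearMap

variable {H : Type*} [NormedAddCommGroup H] [InnerProductSpace ℂ H]

/-! ### Principal ideals -/

theorem mem_principalIdeal_self (T : H →L[ℂ] H) : T ∈ principalIdeal T :=
  TwoSidedIdeal.subset_span rfl

theorem mul_mul_mem_principalIdeal (T L R : H →L[ℂ] H) : L * T * R ∈ principalIdeal T :=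
  TwoSidedIdeal.mul_mem_right _ _ _ (TwoSidedIdeal.mul_mem_left _ _ _ (mem_principalIdeal_self T))

theorem principalIdeal_le {S T : H →L[ℂ] H} (h : S ∈ principalIdeal T) :
    principalIdeal S ≤ principalIdeal T :=
  TwoSidedIdeal.span_le.2 (by simpa using h)

/-! ### Operators given on an orthonormal basis -/

theorem eq_of_inner_basis {ι : Type*} (e : HilbertBasis ι ℂ H) {v w : H}
    (h : ∀ i, inner ℂ (e i) v = inner ℂ (e i) w) : v = w := by
  apply e.repr.injective
  ext i
  rw [e.repr_apply_apply, e.repr_apply_apply, h]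

theorem eq_of_apply_basis {ι : Type*} (e : HilbertBasis ι ℂ H) {S T : H →L[ℂ] H}
    (h : ∀ j, S (e j) = T (e j)) : S = T :=
  HasMatrix.unique (e := e) (M := fun i j => inner ℂ (e i) (T (e j)))
    (fun i j => by rw [h]) (fun _ _ => rfl)

theorem inner_basis {ι : Type*} [DecidableEq ι] (e : HilbertBasis ι ℂ H) (p q : ι) :
    inner ℂ (e p) (e q) = if p = q then (1 : ℂ) else 0 :=
  orthonormal_iff_ite.1 e.orthonormal p q

theorem HasMatrix.apply_diagonal {ι : Type*} [DecidableEq ι] {f : HilbertBasis ι ℂ H}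
    {D : H →L[ℂ] H} {d : ι → ℂ} (h : HasMatrix f D (Matrix.diagonal d)) (n : ι) :
    D (f n) = d n • f n := by
  refine eq_of_inner_basis f fun i => ?_
  rw [h, inner_smul_right, inner_basis, Matrix.diagonal_apply]
  split_ifs with hi <;> simp [hi]

/-- Two weighted shifts commute if their index maps and their weights do. -/
theorem mul_comm_of_weights {ι : Type*} {e : HilbertBasis ι ℂ H} {σ τ : ι → ι}
    (h : ∀ p, τ (σ p) = σ (τ p)) {u v : ι → ℝ} {S R : H →L[ℂ] H}
    (hS : ∀ p, S (e p) = (u p : ℂ) • e (σ p)) (hR : ∀ p, R (e p) = (v p : ℂ) • e (τ p))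
    (huv : ∀ p, u p * v (σ p) = v p * u (τ p)) : S * R = R * S := by
  refine eq_of_apply_basis e fun p => ?_
  change S (R (e p)) = R (S (e p))
  rw [hS, hR, map_smul, map_smul, hS, hR, smul_smul, smul_smul, h, ← Complex.ofReal_mul,
    ← Complex.ofReal_mul, huv]

variable [CompleteSpace H]

/-- Weighted shifts with bounded weights from one orthonormal basis into another are bounded. -/
theorem exists_weighted_of_le {ι κ : Type*} (e : HilbertBasis ι ℂ H) (f : HilbertBasis κ ℂ H)
    (σ : ι → κ) (hσ : Function.Injective σ) (w : ι → ℂ) (K : ℝ) (hK : 0 < K)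
    (hw : ∀ i, ‖w i‖ ≤ K) : ∃ T : H →L[ℂ] H, ∀ j, T (e j) = w j • f (σ j) := by
  classical
  have hK' : (K : ℂ) ≠ 0 := by exact_mod_cast hK.ne'
  obtain ⟨D, hD⟩ := exists_weighted e id Function.injective_id (fun i => w i / K) (fun i => by
    rw [norm_div, Complex.norm_real, Real.norm_of_nonneg hK.le, div_le_one hK]
    exact hw i)
  have ho : Orthonormal ℂ (fun i => f (σ i)) := f.orthonormal.comp σ hσ
  let V := ho.orthogonalFamily.linearIsometry
  refine ⟨(V.toContinuousLinearMap ∘L e.repr.toLinearIsometry.toContinuousLinearMap) ∘L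
    ((K : ℂ) • D), fun j => ?_⟩
  have hV : V (e.repr (e j)) = f (σ j) := by
    rw [e.repr_self]
    simp [V, OrthogonalFamily.linearIsometry_apply_single]
  change V (e.repr ((K : ℂ) • D (e j))) = _
  rw [hD, smul_smul, mul_div_cancel₀ _ hK', map_smul, map_smul, id, hV]

/-- The adjoint of a weighted shift, on a basis vector in the range of the shift. -/
theorem adjoint_apply_image {ι κ : Type*} {e : HilbertBasis ι ℂ H} {f : HilbertBasis κ ℂ H}
    {σ : ι → κ} (hσ : Function.Injective σ) {w : ι → ℂ} {T : H →L[ℂ] H}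
    (hT : ∀ j, T (e j) = w j • f (σ j)) (j : ι) : adjoint T (f (σ j)) = star (w j) • e j := by
  classical
  refine eq_of_inner_basis e fun i => ?_
  rw [adjoint_inner_right, hT, inner_smul_left, inner_smul_right, inner_basis, inner_basis]
  by_cases h : i = j
  · subst h; simp
  · simp [h, hσ.ne h]

/-- The adjoint of a weighted shift vanishes on the basis vectors outside the range of the
shift. -/
theorem adjoint_apply_eq_zero {ι κ : Type*} {e : HilbertBasis ι ℂ H} {f : HilbertBasis κ ℂ H}
    {σ : ι → κ} {w : ι → ℂ} {T : H →L[ℂ] H}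
    (hT : ∀ j, T (e j) = w j • f (σ j)) {q : κ} (hq : ∀ j, q ≠ σ j) : adjoint T (f q) = 0 := by
  classical
  refine eq_of_inner_basis e fun i => ?_
  rw [adjoint_inner_right, hT, inner_smul_left, inner_basis, if_neg (hq i).symm]
  simp

/-! ### Weighted shifts and diagonal operators in principal ideals -/

/-- A weighted shift whose weights are dominated by diagonal entries, assigned injectively, of a
self-adjoint diagonal operator `D` lies in the ideal generated by `D`, and so does its adjoint. -/
theorem exists_weighted_mem_principalIdeal {ι κ : Type*} [DecidableEq κ] (e : HilbertBasis ι ℂ H)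
    (f : HilbertBasis κ ℂ H) {D : H →L[ℂ] H} {d : κ → ℝ}
    (hD : HasMatrix f D (Matrix.diagonal fun n => (d n : ℂ)))
    (φ : ι → κ) (hφ : Function.Injective φ) (σ : ι → ι) (hσ : Function.Injective σ) (u : ι → ℝ)
    (hu : ∀ p, |u p| ≤ |d (φ p)|) :
    ∃ S : H →L[ℂ] H, (∀ p, S (e p) = (u p : ℂ) • e (σ p)) ∧
      S ∈ principalIdeal D ∧ adjoint S ∈ principalIdeal D := by
  obtain ⟨V, hV⟩ := exists_weighted_of_le e f φ hφ (fun p => ((u p / d (φ p) : ℝ) : ℂ)) 1 one_pos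
    (fun p => by
      rw [Complex.norm_real, Real.norm_eq_abs, abs_div]
      exact div_le_one_of_le₀ (hu p) (abs_nonneg _))
  obtain ⟨V', hV'⟩ := exists_weighted_of_le e f φ hφ (fun _ => 1) 1 one_pos (by simp)
  obtain ⟨W, hW⟩ := exists_weighted_of_le e e σ hσ (fun _ => 1) 1 one_pos (by simp)
  have hDa : adjoint D = D := by
    refine eq_of_apply_basis f fun n => eq_of_inner_basis f fun i => ?_
    rw [adjoint_inner_right, hD.apply_diagonal, hD.apply_diagonal, inner_smul_left,
      inner_smul_right, inner_basis]
    split_ifs with h <;> simp [h]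
  refine ⟨(W * adjoint V') * D * V, fun p => ?_, mul_mul_mem_principalIdeal _ _ _, ?_⟩
  · have h0 : (u p / d (φ p)) * d (φ p) = u p := by
      by_cases h : d (φ p) = 0
      · have := hu p
        rw [h, abs_zero] at this
        rw [h, mul_zero, abs_nonpos_iff.1 this]
      · exact div_mul_cancel₀ _ h
    change W (adjoint V' (D (V (e p)))) = _
    rw [hV, map_smul, hD.apply_diagonal, smul_smul, ← Complex.ofReal_mul, h0, map_smul,
      adjoint_apply_image hφ hV', map_smul, map_smul, hW]
    simp
  · have : adjoint ((W * adjoint V') * D * V) = adjoint V * D * (V' * adjoint W) := by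
      simp only [← star_eq_adjoint, star_mul, star_star, mul_assoc]
      rw [star_eq_adjoint D, hDa]
    rw [this]
    exact mul_mul_mem_principalIdeal _ _ _

/-- If the rows `h i` and the columns `g i` cut a diagonal matrix out of the matrix of `T`, then
the ideal generated by `T` contains every diagonal operator dominated by that diagonal. -/
theorem mem_principalIdeal_of_diagonal_submatrix {ι κ : Type*} [DecidableEq κ]
    {e : HilbertBasis ι ℂ H} {T : H →L[ℂ] H} {M : Matrix ι ι ℂ} (hT : HasMatrix e T M)
    {f : HilbertBasis κ ℂ H} {D : H →L[ℂ] H} {d : κ → ℂ} (hD : HasMatrix f D (Matrix.diagonal d))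
    {g h : κ → ι} (hg : Function.Injective g) (hh : Function.Injective h)
    (hM : ∀ i j, i ≠ j → M (h i) (g j) = 0) {K : ℝ} (hK : 0 < K)
    (hd : ∀ i, ‖d i‖ ≤ K * ‖M (h i) (g i)‖) : D ∈ principalIdeal T := by
  obtain ⟨V, hV⟩ := exists_weighted_of_le f e g hg (fun i => d i / M (h i) (g i)) K hK
    (fun i => by
      rw [norm_div]
      exact div_le_of_le_mul₀ (norm_nonneg _) hK.le (hd i))
  obtain ⟨W, hW⟩ := exists_weighted_of_le f e h hh (fun _ => 1) 1 one_pos (by simp)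
  have : adjoint W * T * V = D := by
    refine eq_of_apply_basis f fun j => eq_of_inner_basis f fun i => ?_
    change inner ℂ (f i) (adjoint W (T (V (f j)))) = _
    rw [adjoint_inner_right, hV, hW, one_smul, map_smul, inner_smul_right, hT, hD,
      Matrix.diagonal_apply]
    split_ifs with hij
    · subst hij
      by_cases h0 : M (h i) (g i) = 0
      · have := hd i
        rw [h0, norm_zero, mul_zero, norm_le_zero_iff] at this
        simp [this]
      · exact div_mul_cancel₀ _ h0
    · rw [hM i j hij, mul_zero]
  rw [← this]
  exact mul_mul_mem_principalIdeal _ _ _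

/-! ### The entries and the sequence `n ^ (-1/4)` -/

theorem fourthRootSeq_eq (n : ℕ) : fourthRootSeq n = 1 / √√((n : ℝ) + 1) := by
  have h0 : (0 : ℝ) ≤ (n : ℝ) + 1 := by positivity
  rw [fourthRootSeq, Real.rpow_neg h0, Real.sqrt_eq_rpow, Real.sqrt_eq_rpow, ← Real.rpow_mul h0,
    one_div]
  norm_num

theorem fourthRootSeq_nonneg (n : ℕ) : 0 ≤ fourthRootSeq n := by
  unfold fourthRootSeq; positivity

/-- The injection `(m, i) ↦ Nat.pair i m` takes the block of size `m + 1` below `(m + 1) ^ 2`. -/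
theorem one_div_sqrt_le_fourthRootSeq (p : BlockIndex) :
    1 / √((p.1 : ℝ) + 1) ≤ fourthRootSeq (Nat.pair p.2 p.1) := by
  have h1 : Nat.pair p.2 p.1 + 1 ≤ (p.1 + 1) ^ 2 := by
    have := Nat.pair_lt_max_add_one_sq p.2 p.1
    rwa [max_eq_right (Nat.lt_succ_iff.1 p.2.2)] at this
  have h2 : ((Nat.pair p.2 p.1 : ℕ) : ℝ) + 1 ≤ ((p.1 : ℝ) + 1) ^ 2 := by exact_mod_cast h1
  rw [fourthRootSeq_eq]
  refine one_div_le_one_div_of_le (by positivity) (Real.sqrt_le_sqrt ?_)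
  exact Real.sqrt_le_iff.2 ⟨by positivity, h2⟩

theorem pair_injective : Function.Injective fun p : BlockIndex => Nat.pair p.2 p.1 := by
  intro p q h
  obtain ⟨h2, h1⟩ := Nat.pair_eq_pair.1 h
  exact blockIndex_ext h1 h2

theorem abs_sqrt_div_le_one_div_sqrt {s n t : ℝ} (hn : 0 < n) (hs : s ≤ n) (ht : n ≤ t) :
    |√s / t| ≤ 1 / √n := by
  have h0 : 0 < √n := Real.sqrt_pos.2 hn
  rw [abs_of_nonneg (div_nonneg (Real.sqrt_nonneg _) (hn.le.trans ht)),
    div_le_div_iff₀ (by linarith) h0, one_mul]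
  calc √s * √n ≤ √n * √n := by gcongr
    _ = n := Real.mul_self_sqrt hn.le
    _ ≤ t := ht

theorem exists_shift_mem_principalIdeal (e : HilbertBasis BlockIndex ℂ H)
    (f : HilbertBasis ℕ ℂ H) (σ : BlockIndex → BlockIndex) (hσ : Function.Injective σ)
    (u : BlockIndex → ℝ) (hu : ∀ p, |u p| ≤ 1 / √((p.1 : ℝ) + 1)) :
    ∃ S : H →L[ℂ] H, (∀ p, S (e p) = (u p : ℂ) • e (σ p)) ∧
      S ∈ principalIdeal (diagFourthRoot f) ∧ adjoint S ∈ principalIdeal (diagFourthRoot f) :=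
  exists_weighted_mem_principalIdeal e f (hasMatrix_opOfMatrix _ _ (exists_diagFourthRoot f))
    (fun p => Nat.pair p.2 p.1) pair_injective σ hσ u (fun p =>
      (hu p).trans ((one_div_sqrt_le_fourthRootSeq p).trans (le_abs_self _)))

theorem abs_a_le (p : BlockIndex) : |a (p.2 + 1) (p.1 + 1)| ≤ 1 / √((p.1 : ℝ) + 1) := by
  unfold a
  push_cast
  refine abs_sqrt_div_le_one_div_sqrt (by positivity) ?_ le_rfl
  linarith [Nat.cast_nonneg (α := ℝ) (p.2 : ℕ)]

theorem abs_b_le (p : BlockIndex) : |b (p.2 + 1) (p.1 + 1)| ≤ 1 / √((p.1 : ℝ) + 1) := by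
  have : ((p.2 : ℕ) : ℝ) ≤ p.1 := by exact_mod_cast Nat.lt_succ_iff.1 p.2.2
  unfold b
  push_cast
  exact abs_sqrt_div_le_one_div_sqrt (by positivity) (by linarith) (by linarith)

theorem abs_x_le (p : BlockIndex) : |x (p.2 + 1) (p.1 + 1)| ≤ 1 / √((p.1 : ℝ) + 1) := by
  have : ((p.2 : ℕ) : ℝ) ≤ p.1 := by exact_mod_cast Nat.lt_succ_iff.1 p.2.2
  unfold x
  push_cast
  exact abs_sqrt_div_le_one_div_sqrt (by positivity) (by linarith) le_rfl

theorem abs_y_le (p : BlockIndex) : |y (p.2 + 1) (p.1 + 1)| ≤ 1 / √((p.1 : ℝ) + 1) := by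
  unfold y
  push_cast
  refine abs_sqrt_div_le_one_div_sqrt (by positivity) ?_ (by linarith)
  linarith [Nat.cast_nonneg (α := ℝ) (p.2 : ℕ)]

/-! ### `C` and `Z` as sums of weighted shifts -/

theorem inner_adjoint_add {ι : Type*} [DecidableEq ι] {e : HilbertBasis ι ℂ H} {σ τ : ι → ι}
    {u v : ι → ℝ} {S R : H →L[ℂ] H} (hS : ∀ p, S (e p) = (u p : ℂ) • e (σ p))
    (hR : ∀ p, R (e p) = (v p : ℂ) • e (τ p)) (p q : ι) :
    inner ℂ (e p) ((adjoint S + R) (e q)) =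
      (if q = σ p then (u p : ℂ) else 0) + (if p = τ q then (v q : ℂ) else 0) := by
  rw [_root_.add_apply, inner_add_right, adjoint_inner_right,
    hS, hR, inner_smul_left, inner_smul_right, inner_basis, inner_basis]
  simp [eq_comm]

theorem exists_C_eq_adjoint_add (e : HilbertBasis BlockIndex ℂ H) (f : HilbertBasis ℕ ℂ H) :
    ∃ S R : H →L[ℂ] H, (∀ p, S (e p) = ((a (p.2 + 1) (p.1 + 1) : ℝ) : ℂ) • e (shift p)) ∧
      (∀ p, R (e p) = ((-b (p.2 + 1) (p.1 + 1) : ℝ) : ℂ) • e (shiftSucc p)) ∧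
      C e = adjoint S + R ∧ C e ∈ principalIdeal (diagFourthRoot f) := by
  obtain ⟨S, hS, -, hS'⟩ := exists_shift_mem_principalIdeal e f shift shift_injective
    (fun p => a (p.2 + 1) (p.1 + 1)) abs_a_le
  obtain ⟨R, hR, hR', -⟩ := exists_shift_mem_principalIdeal e f shiftSucc shiftSucc_injective
    (fun p => -b (p.2 + 1) (p.1 + 1)) (fun p => by rw [abs_neg]; exact abs_b_le p)
  have : C e = adjoint S + R := by
    refine HasMatrix.unique (hasMatrix_opOfMatrix _ _ (exists_C e)) fun p q => ?_
    rw [inner_adjoint_add hS hR]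
    simp only [eq_shift_iff, eq_shiftSucc_iff, blockMatrix, A, B]
    split_ifs <;> first | omega | simp_all
  exact ⟨S, R, hS, hR, this, this ▸ add_mem hS' hR'⟩

theorem exists_Z_eq_adjoint_add (e : HilbertBasis BlockIndex ℂ H) (f : HilbertBasis ℕ ℂ H) :
    ∃ S R : H →L[ℂ] H, (∀ p, S (e p) = ((x (p.2 + 1) (p.1 + 1) : ℝ) : ℂ) • e (shiftSucc p)) ∧
      (∀ p, R (e p) = ((y (p.2 + 1) (p.1 + 1) : ℝ) : ℂ) • e (shift p)) ∧
      Z e = adjoint S + R ∧ Z e ∈ principalIdeal (diagFourthRoot f) := by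
  obtain ⟨S, hS, -, hS'⟩ := exists_shift_mem_principalIdeal e f shiftSucc shiftSucc_injective
    (fun p => x (p.2 + 1) (p.1 + 1)) abs_x_le
  obtain ⟨R, hR, hR', -⟩ := exists_shift_mem_principalIdeal e f shift shift_injective
    (fun p => y (p.2 + 1) (p.1 + 1)) abs_y_le
  have : Z e = adjoint S + R := by
    refine HasMatrix.unique (hasMatrix_opOfMatrix _ _ (exists_Z e)) fun p q => ?_
    rw [inner_adjoint_add hS hR]
    simp only [eq_shift_iff, eq_shiftSucc_iff, blockMatrix, X, Y]
    split_ifs <;> first | omega | simp_all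
  exact ⟨S, R, hS, hR, this, this ▸ add_mem hS' hR'⟩

/-! ### The commutator -/

theorem shiftSucc_shift (p : BlockIndex) : shiftSucc (shift p) = shift (shiftSucc p) :=
  blockIndex_ext rfl rfl

theorem a_mul_x (p : BlockIndex) :
    a (p.2 + 1) (p.1 + 1) * x ((shift p).2 + 1) ((shift p).1 + 1) =
      x (p.2 + 1) (p.1 + 1) * a ((shiftSucc p).2 + 1) ((shiftSucc p).1 + 1) := by
  simp only [shift, shiftSucc, Fin.val_castSucc, Fin.val_succ, a, x]
  rw [show ((p.1 + 1 + 1 : ℕ) : ℝ) + 1 - ((p.2 + 1 + 1 : ℕ) : ℝ) =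
    ((p.1 + 1 : ℕ) : ℝ) + 1 - ((p.2 + 1 : ℕ) : ℝ) by push_cast; ring]
  ring

theorem b_mul_y (p : BlockIndex) :
    -b (p.2 + 1) (p.1 + 1) * y ((shiftSucc p).2 + 1) ((shiftSucc p).1 + 1) =
      y (p.2 + 1) (p.1 + 1) * -b ((shift p).2 + 1) ((shift p).1 + 1) := by
  simp only [shift, shiftSucc, Fin.val_castSucc, Fin.val_succ, b, y]
  rw [show ((p.1 + 1 + 1 : ℕ) : ℝ) + 1 - ((p.2 + 1 + 1 : ℕ) : ℝ) =
    ((p.1 + 1 : ℕ) : ℝ) + 1 - ((p.2 + 1 : ℕ) : ℝ) by push_cast; ring]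
  ring

theorem a_mul_y (p : BlockIndex) : a (p.2 + 1) (p.1 + 1) * y (p.2 + 1) (p.1 + 1) =
    ((p.1 : ℝ) + 1 - (p.2 : ℕ)) / (((p.1 : ℝ) + 1) * ((p.1 : ℝ) + 2)) := by
  have : ((p.2 : ℕ) : ℝ) ≤ p.1 := by exact_mod_cast Nat.lt_succ_iff.1 p.2.2
  unfold a y
  rw [div_mul_div_comm, Real.mul_self_sqrt (by push_cast; linarith)]
  push_cast
  congr 1 <;> ring

theorem b_mul_x (p : BlockIndex) : b (p.2 + 1) (p.1 + 1) * x (p.2 + 1) (p.1 + 1) =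
    (((p.2 : ℕ) : ℝ) + 1) / (((p.1 : ℝ) + 1) * ((p.1 : ℝ) + 2)) := by
  unfold b x
  rw [div_mul_div_comm, Real.mul_self_sqrt (by positivity)]
  push_cast
  congr 1; ring

theorem eq_shift_or (q : BlockIndex) :
    (∃ p, q = shift p) ∨ ((q.2 : ℕ) = q.1 ∧ ∀ p, q ≠ shift p) := by
  obtain ⟨m, i⟩ := q
  by_cases h : (i : ℕ) = m
  · refine Or.inr ⟨h, fun p hp => ?_⟩
    obtain ⟨h1, h2⟩ := eq_shift_iff.1 hp
    have := p.2.2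
    simp only at h1 h2
    omega
  · have := i.2
    exact Or.inl ⟨⟨m - 1, ⟨i, by omega⟩⟩, eq_shift_iff.2 ⟨by simp only; omega, rfl⟩⟩

theorem eq_shiftSucc_or (q : BlockIndex) :
    (∃ p, q = shiftSucc p) ∨ ((q.2 : ℕ) = 0 ∧ ∀ p, q ≠ shiftSucc p) := by
  obtain ⟨m, i⟩ := q
  by_cases h : (i : ℕ) = 0
  · refine Or.inr ⟨h, fun p hp => ?_⟩
    have h2 := (eq_shiftSucc_iff.1 hp).2
    simp only at h2
    omega
  · have := i.2
    exact Or.inl ⟨⟨m - 1, ⟨i - 1, by omega⟩⟩,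
      eq_shiftSucc_iff.2 ⟨by simp only; omega, by simp only; omega⟩⟩

theorem commutator_eq (e : HilbertBasis BlockIndex ℂ H) {S R S' R' : H →L[ℂ] H}
    (hS : ∀ p, S (e p) = ((a (p.2 + 1) (p.1 + 1) : ℝ) : ℂ) • e (shift p))
    (hR : ∀ p, R (e p) = ((-b (p.2 + 1) (p.1 + 1) : ℝ) : ℂ) • e (shiftSucc p))
    (hS' : ∀ p, S' (e p) = ((x (p.2 + 1) (p.1 + 1) : ℝ) : ℂ) • e (shiftSucc p))
    (hR' : ∀ p, R' (e p) = ((y (p.2 + 1) (p.1 + 1) : ℝ) : ℂ) • e (shift p)) :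
    (adjoint S + R) * (adjoint S' + R') - (adjoint S' + R') * (adjoint S + R) =
      (Submodule.span ℂ {e ⟨0, 0⟩}).starProjection := by
  have hSS : adjoint S * adjoint S' = adjoint S' * adjoint S := by
    have h := mul_comm_of_weights shiftSucc_shift hS hS' a_mul_x
    have := congrArg star h
    simpa [star_mul, star_eq_adjoint] using this.symm
  have hRR : R * R' = R' * R :=
    mul_comm_of_weights (fun p => (shiftSucc_shift p).symm) hR hR' b_mul_y
  -- Only the products of a raising and a lowering shift along the same index map remain.
  have key : (adjoint S + R) * (adjoint S' + R') - (adjoint S' + R') * (adjoint S + R) =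
      adjoint S * R' - R' * adjoint S + (R * adjoint S' - adjoint S' * R) := by
    rw [add_mul, mul_add, mul_add, add_mul, mul_add, mul_add, hSS, hRR]
    abel
  rw [key]
  refine eq_of_apply_basis e fun q => ?_
  have h1 : adjoint S (R' (e q)) =
      ((((q.1 : ℝ) + 1 - (q.2 : ℕ)) / (((q.1 : ℝ) + 1) * ((q.1 : ℝ) + 2)) : ℝ) : ℂ) • e q := by
    rw [hR', map_smul, adjoint_apply_image shift_injective hS, smul_smul, ← a_mul_y,
      Complex.star_def, Complex.conj_ofReal, ← Complex.ofReal_mul, mul_comm]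
  have h2 : adjoint S' (R (e q)) =
      ((-((((q.2 : ℕ) : ℝ) + 1) / (((q.1 : ℝ) + 1) * ((q.1 : ℝ) + 2))) : ℝ) : ℂ) • e q := by
    rw [hR, map_smul, adjoint_apply_image shiftSucc_injective hS', smul_smul, ← b_mul_x,
      Complex.star_def, Complex.conj_ofReal, ← Complex.ofReal_mul, neg_mul]
  -- In block `0` the next two quotients are `0 / 0`, and the operators do vanish there.
  have h3 : R' (adjoint S (e q)) =
      ((((q.1 : ℝ) - (q.2 : ℕ)) / ((q.1 : ℝ) * ((q.1 : ℝ) + 1)) : ℝ) : ℂ) • e q := by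
    obtain ⟨p, rfl⟩ | ⟨hq, hq'⟩ := eq_shift_or q
    · rw [adjoint_apply_image shift_injective hS, map_smul, hR', smul_smul, Complex.star_def,
        Complex.conj_ofReal, ← Complex.ofReal_mul, a_mul_y]
      simp only [shift, Fin.val_castSucc, Nat.cast_add, Nat.cast_one]
      congr 3
      ring
    · rw [adjoint_apply_eq_zero hS hq', hq]
      simp
  have h4 : R (adjoint S' (e q)) =
      ((-(((q.2 : ℕ) : ℝ) / ((q.1 : ℝ) * ((q.1 : ℝ) + 1))) : ℝ) : ℂ) • e q := by
    obtain ⟨p, rfl⟩ | ⟨hq, hq'⟩ := eq_shiftSucc_or q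
    · rw [adjoint_apply_image shiftSucc_injective hS', map_smul, hR, smul_smul, Complex.star_def,
        Complex.conj_ofReal, ← Complex.ofReal_mul, mul_comm, neg_mul, b_mul_x]
      simp only [shiftSucc, Fin.val_succ, Nat.cast_add, Nat.cast_one]
      congr 4
      ring
    · rw [adjoint_apply_eq_zero hS' hq', hq]
      simp
  change adjoint S (R' (e q)) - R' (adjoint S (e q)) +
    (R (adjoint S' (e q)) - adjoint S' (R (e q))) = _
  rw [h1, h2, h3, h4, ← sub_smul, ← sub_smul, ← add_smul,
    Submodule.starProjection_unit_singleton ℂ (e.orthonormal.1 _), inner_basis]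
  obtain ⟨m, i⟩ := q
  simp only
  rw [← Complex.ofReal_sub, ← Complex.ofReal_sub, ← Complex.ofReal_add]
  by_cases hm : m = 0
  · subst hm
    obtain rfl : i = 0 := Fin.ext (by have := i.2; simp only [Fin.val_zero]; omega)
    norm_num
  · rw [if_neg (fun h => hm (congrArg Sigma.fst h).symm)]
    have hm' : (m : ℝ) ≠ 0 := by exact_mod_cast hm
    have : ((m : ℝ) + 1 - (i : ℕ)) / (((m : ℝ) + 1) * ((m : ℝ) + 2)) -
        ((m : ℝ) - (i : ℕ)) / ((m : ℝ) * ((m : ℝ) + 1)) +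
        (-(((i : ℕ) : ℝ) / ((m : ℝ) * ((m : ℝ) + 1))) -
          -((((i : ℕ) : ℝ) + 1) / (((m : ℝ) + 1) * ((m : ℝ) + 2)))) = 0 := by
      field_simp
      ring
    rw [this]
    simp

/-! ### Diagonal submatrices of `C` and `Z` -/

/-- The `n`-th pair `(i, j)` of natural numbers, placed at position `i` of the block of number
`3 (i + j)`, so in its first third. -/
def sparseIndex (n : ℕ) : BlockIndex :=
  ⟨3 * (n.unpair.1 + n.unpair.2), ⟨n.unpair.1, by omega⟩⟩

theorem sparseIndex_injective : Function.Injective sparseIndex := fun m n h => by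
  have h1 : 3 * (m.unpair.1 + m.unpair.2) = 3 * (n.unpair.1 + n.unpair.2) := congrArg Sigma.fst h
  have h2 : m.unpair.1 = n.unpair.1 := congrArg (fun p : BlockIndex => (p.2 : ℕ)) h
  rw [← Nat.pair_unpair m, ← Nat.pair_unpair n, h2, show m.unpair.2 = n.unpair.2 by omega]

theorem sparseIndex_fst_le (n : ℕ) : ((sparseIndex n).1 : ℝ) + 1 ≤ 7 * √((n : ℝ) + 1) := by
  have h : max n.unpair.1 n.unpair.2 ^ 2 ≤ n := by
    have := Nat.max_sq_add_min_le_pair n.unpair.1 n.unpair.2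
    rw [Nat.pair_unpair] at this
    omega
  have h' : ((max n.unpair.1 n.unpair.2 : ℕ) : ℝ) ≤ √((n : ℝ) + 1) := by
    refine Real.le_sqrt_of_sq_le ?_
    have : ((max n.unpair.1 n.unpair.2 : ℕ) : ℝ) ^ 2 ≤ n := by exact_mod_cast h
    linarith
  have h1 : (1 : ℝ) ≤ √((n : ℝ) + 1) := Real.one_le_sqrt.2 (by simp)
  have h2 : ((sparseIndex n).1 : ℝ) ≤ 6 * ((max n.unpair.1 n.unpair.2 : ℕ) : ℝ) := by
    have : (sparseIndex n).1 ≤ 6 * max n.unpair.1 n.unpair.2 := by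
      simp only [sparseIndex]
      omega
    exact_mod_cast this
  linarith

/-- The common lower bound for the entries of `A` and of `Y` along `sparseIndex`. -/
theorem fourthRootSeq_le (n : ℕ) {s t : ℝ} (ht : 0 < t)
    (hs : ((sparseIndex n).1 + 1 : ℝ) / 2 ≤ s) (hst : t ≤ 2 * ((sparseIndex n).1 + 1)) :
    fourthRootSeq n ≤ 8 * (√s / t) := by
  set M : ℝ := (sparseIndex n).1 + 1
  have hM : 0 < M := by positivity
  have hM7 : M ≤ 7 * √((n : ℝ) + 1) := sparseIndex_fst_le n
  have hr : 0 < √((n : ℝ) + 1) := by positivity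
  rw [fourthRootSeq_eq, mul_div_assoc', div_le_div_iff₀ (by positivity) ht, one_mul]
  calc t ≤ 2 * M := hst
    _ ≤ √(64 * (s * √((n : ℝ) + 1))) := by
      refine Real.le_sqrt_of_sq_le ?_
      -- `s ≥ M / 2` and `√(n + 1) ≥ M / 7` give `64 s √(n + 1) ≥ (32 / 7) M² ≥ (2 M)²`.
      nlinarith [mul_le_mul hs hM7 hM.le (by linarith)]
    _ = 8 * √s * √√((n : ℝ) + 1) := by
      rw [Real.sqrt_mul (by norm_num), Real.sqrt_mul (by linarith),
        show (64 : ℝ) = 8 ^ 2 by norm_num, Real.sqrt_sq (by norm_num), mul_assoc]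

theorem blockMatrix_shift_right (U : ∀ n : ℕ, Matrix (Fin n) (Fin (n + 1)) ℂ)
    (L : ∀ n : ℕ, Matrix (Fin (n + 1)) (Fin n) ℂ) (p : BlockIndex) :
    blockMatrix U L p (shift p) = U (p.1 + 1) p.2 p.2.castSucc :=
  dif_pos rfl

theorem blockMatrix_shift_left (U : ∀ n : ℕ, Matrix (Fin n) (Fin (n + 1)) ℂ)
    (L : ∀ n : ℕ, Matrix (Fin (n + 1)) (Fin n) ℂ) (p : BlockIndex) :
    blockMatrix U L (shift p) p = L (p.1 + 1) p.2.castSucc p.2 :=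
  (dif_neg (show ¬ p.1 = p.1 + 1 + 1 by omega)).trans (dif_pos rfl)

theorem sparseIndex_position_le (n : ℕ) :
    3 * (((sparseIndex n).2 : ℕ) : ℝ) ≤ (sparseIndex n).1 := by
  have : 3 * ((sparseIndex n).2 : ℕ) ≤ (sparseIndex n).1 := by
    simp only [sparseIndex]
    omega
  exact_mod_cast this

theorem diagFourthRoot_mem_principalIdeal_C (e : HilbertBasis BlockIndex ℂ H)
    (f : HilbertBasis ℕ ℂ H) : diagFourthRoot f ∈ principalIdeal (C e) := by
  refine mem_principalIdeal_of_diagonal_submatrix (hasMatrix_opOfMatrix _ _ (exists_C e))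
    (hasMatrix_opOfMatrix _ _ (exists_diagFourthRoot f))
    (g := fun n => shift (sparseIndex n)) (h := sparseIndex)
    (shift_injective.comp sparseIndex_injective) sparseIndex_injective
    (fun i j hij => ?_) (K := 8) (by norm_num) (fun n => ?_)
  · have hne := sparseIndex_injective.ne hij
    -- Entries of `B` are not hit: rows are in blocks `≡ 0`, columns in blocks `≡ 1` modulo `3`.
    simp only [blockMatrix, A]
    split_ifs with h1 h2 h3
    · refine absurd (blockIndex_ext ?_ ?_) hne
      · simp only [shift] at h1; omega
      · exact h2.symm
    · rfl
    all_goals first | rfl | (simp only [shift, sparseIndex] at h3; omega)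
  · have h := sparseIndex_position_le n
    have h0 := Nat.cast_nonneg (α := ℝ) ((sparseIndex n).2 : ℕ)
    rw [blockMatrix_shift_right, Complex.norm_real, Real.norm_of_nonneg (fourthRootSeq_nonneg n)]
    simp only [A, Fin.val_castSucc, if_true]
    rw [Complex.norm_real]
    refine le_trans (fourthRootSeq_le n (t := (((sparseIndex n).1 + 1 : ℕ) : ℝ)) (by positivity)
      ?_ ?_) (mul_le_mul_of_nonneg_left (le_abs_self _) (by norm_num)) <;> push_cast <;> linarith

theorem diagFourthRoot_mem_principalIdeal_Z (e : HilbertBasis BlockIndex ℂ H)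
    (f : HilbertBasis ℕ ℂ H) : diagFourthRoot f ∈ principalIdeal (Z e) := by
  refine mem_principalIdeal_of_diagonal_submatrix (hasMatrix_opOfMatrix _ _ (exists_Z e))
    (hasMatrix_opOfMatrix _ _ (exists_diagFourthRoot f))
    (g := sparseIndex) (h := fun n => shift (sparseIndex n))
    sparseIndex_injective (shift_injective.comp sparseIndex_injective)
    (fun i j hij => ?_) (K := 8) (by norm_num) (fun n => ?_)
  · have hne := sparseIndex_injective.ne hij
    -- Entries of `X` are not hit: rows are in blocks `≡ 1`, columns in blocks `≡ 0` modulo `3`.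
    simp only [blockMatrix, Y]
    split_ifs with h1 h2 h3
    · simp only [shift, sparseIndex] at h1; omega
    · refine absurd (blockIndex_ext ?_ ?_) hne
      · simp only [shift] at h2; omega
      · exact h3
    all_goals rfl
  · have h := sparseIndex_position_le n
    have h0 := Nat.cast_nonneg (α := ℝ) ((sparseIndex n).2 : ℕ)
    rw [blockMatrix_shift_left, Complex.norm_real, Real.norm_of_nonneg (fourthRootSeq_nonneg n)]
    simp only [Y, Fin.val_castSucc, if_true]
    rw [Complex.norm_real]
    refine le_trans (fourthRootSeq_le n (t := (((sparseIndex n).1 + 1 : ℕ) : ℝ) + 1)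
      (by positivity) ?_ ?_) (mul_le_mul_of_nonneg_left (le_abs_self _) (by norm_num)) <;>
      push_cast <;> linarith

end Anderson

end

theorem mainTheorem12 {H : Type*} [NormedAddCommGroup H] [InnerProductSpace ℂ H]
    [CompleteSpace H] (e : HilbertBasis Anderson.BlockIndex ℂ H) (f : HilbertBasis ℕ ℂ H) :
    Anderson.C e * Anderson.Z e - Anderson.Z e * Anderson.C e =
        (Submodule.span ℂ {e ⟨0, 0⟩}).starProjection ∧
      Anderson.principalIdeal (Anderson.C e) = Anderson.principalIdeal (Anderson.Z e) ∧
      Anderson.principalIdeal (Anderson.Z e) =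
        Anderson.principalIdeal (Anderson.diagFourthRoot f) := by
  obtain ⟨S, R, hS, hR, hC, hC'⟩ := Anderson.exists_C_eq_adjoint_add e f
  obtain ⟨S', R', hS', hR', hZ, hZ'⟩ := Anderson.exists_Z_eq_adjoint_add e f
  have hCd := le_antisymm (Anderson.principalIdeal_le hC')
    (Anderson.principalIdeal_le (Anderson.diagFourthRoot_mem_principalIdeal_C e f))
  have hZd := le_antisymm (Anderson.principalIdeal_le hZ')
    (Anderson.principalIdeal_le (Anderson.diagFourthRoot_mem_principalIdeal_Z e f))
  refine ⟨?_, hCd.trans hZd.symm, hZd⟩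
  rw [hC, hZ]
  exact Anderson.commutator_eq e hS hR hS' hR'
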